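/- Let $\mathcal H$ be a separable complex Hilbert space and let $Q_1,Q_2$ be quantum states on $\mathcal H$, i.e. nonnegative trace class operators with $\mathrm{Tr}\,Q_i=1$. For a nonnegative compact operator $A$ let $\sigma(A)=(\tau_1,\tau_2,\dots)$ be the sequence of its eigenvalues, counted with multiplicities, in non-increasing order and continued by zeros if $A$ has finite rank. For a nonnegative trace class operator $A$ put $\det(\mathrm I+A)=\prod_{k}(1+\tau_k)$. If $A=\sum_k\tau_k|\phi_k\rangle\langle\phi_k|$ is a spectral decomposition with non-increasing eigenvalues and $P_n=\sum_{k\le n}|\phi_k\rangle\langle\phi_k|$, define the Gram numbers $g_n(A)=\det(\mathrm I+AP_n)$ (these do not depend on the choice of the decomposition). For nonnegative trace class operators $A,B$ we say that $B$ m-majorises $A$ if $g_n(A)\le g_n(B)$ for all $n$. For a state $Q$ with $\sigma(Q)=(\lambda_1,\lambda_2,\dots)$ let $$S_+(Q)=(\mathrm I+Q)^{\mathrm I+Q}-\mathrm I,\qquad \mathrm{FEN}_\pm(Q)=\log\prod_{k}(1+\lambda_k)^{\pm(1+\lambda_k)}=\pm\sum_k(1+\lambda_k)\log(1+\lambda_k),$$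 where $S_+(Q)$ is defined by the functional calculus. Suppose that $S_+(Q_2)$ m-majorises $S_+(Q_1)$. Then the series defining $\mathrm{FEN}_\pm(Q_1)$ and $\mathrm{FEN}_\pm(Q_2)$ converge, and 1. $\mathrm{FEN}_+(Q_1)\le\mathrm{FEN}_+(Q_2)$; 2. $\mathrm{FEN}_-(Q_1)\ge\mathrm{FEN}_-(Q_2)$; 3. $\mathrm{FEN}_+(Q_1)=\mathrm{FEN}_+(Q_2)$ if and only if $\sigma(Q_1)=\sigma(Q_2)$; 4. $\mathrm{FEN}_-(Q_1)=\mathrm{FEN}_-(Q_2)$ if and only if $\sigma(Q_1)=\sigma(Q_2)$. -/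

import Mathlib

open scoped InnerProductSpace

noncomputable section

namespace RenormEntropy

universe u

variable {H : Type u} [NormedAddCommGroup H] [InnerProductSpace ℂ H] [CompleteSpace H]

/-- `T` is of trace class with trace `z`: in every orthonormal basis the diagonal matrix
elements of `T` are (unconditionally, hence absolutely) summable with sum `z`. -/
def HasTrace (T : H →L[ℂ] H) (z : ℂ) : Prop :=
  ∀ ⦃ι : Type u⦄ (b : HilbertBasis ι ℂ H), HasSum (fun i => ⟪b i, T (b i)⟫_ℂ) z

/-- Quantum states: nonnegative trace class operators of trace one. -/
structure IsState (Q : H →L[ℂ] H) : Prop where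
  isPositive : Q.IsPositive
  hasTrace_one : HasTrace Q 1

/-- The eigenvalue sequence of a compact nonnegative operator `A`, counted with multiplicities
and in non-increasing order, continued by zeros if `A` has finite rank: the entry with index
`n` (counted from `0`) is the largest `t` such that there are `n + 1` orthonormal eigenvectors
of `A` with eigenvalues at least `t`. (If `H` has dimension at most `n`, the set is empty and
the entry is `0`.) -/
def eigenvalueSeq (A : H →L[ℂ] H) (n : ℕ) : ℝ :=
  sSup {t : ℝ | ∃ v : Fin (n + 1) → H, Orthonormal ℂ v ∧
    ∀ i, ∃ s : ℝ, t ≤ s ∧ A (v i) = (s : ℂ) • v i}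

/-- The non-increasing sequence of singular values of a compact operator `A`: the eigenvalues
of `|A| = (A† A) ^ (1/2)`. -/
def singularValueSeq (A : H →L[ℂ] H) : ℕ → ℝ :=
  eigenvalueSeq (CFC.abs A)

/-- The Fredholm determinant `det (I + A)` of a nonnegative trace class operator `A`. -/
def fredholmDet (A : H →L[ℂ] H) : ℝ :=
  ∏' n, (1 + singularValueSeq A n)

/-- `φ` is a sequence of eigenvectors of the compact nonnegative operator `A`, orthonormal and
belonging to the ordered eigenvalue sequence of `A`, so that `A = ∑ τ_n |φ_n⟩⟨φ_n|`.
A vector `φ n` with `τ n = 0` may be zero (there need not be enough unit vectors in the kernel). -/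
structure IsEigenvectorSeq (A : H →L[ℂ] H) (φ : ℕ → H) : Prop where
  apply_eq : ∀ n, A (φ n) = (eigenvalueSeq A n : ℂ) • φ n
  orthogonal : ∀ m n, m ≠ n → ⟪φ m, φ n⟫_ℂ = 0
  norm_eq_one : ∀ n, ‖φ n‖ = 1 ∨ (φ n = 0 ∧ eigenvalueSeq A n = 0)

open Classical in
/-- The spectral sequence of finite dimensional projections of a compact nonnegative operator:
`P n` is the sum of the one-dimensional projections onto the first `n` eigenvectors in a
spectral decomposition of `A` with non-increasing eigenvalues. -/
def spectralProj (A : H →L[ℂ] H) (n : ℕ) : H →L[ℂ] H :=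
  if h : ∃ φ : ℕ → H, IsEigenvectorSeq A φ then
    ∑ i ∈ Finset.range n, InnerProductSpace.rankOne ℂ (h.choose i) (h.choose i)
  else 0

/-- The Gram numbers `g_n(A) = det (I + A P_n)`. -/
def gramNumber (A : H →L[ℂ] H) (n : ℕ) : ℝ :=
  fredholmDet (A * spectralProj A n)

/-- `B` m-majorises `A`. -/
def MMajorizedBy (A B : H →L[ℂ] H) : Prop :=
  ∀ n, gramNumber A n ≤ gramNumber B n

/-- The entropy-generating operator `S_+(Q) = (I + Q)^(I + Q) - I`. -/
def entropyOpPlus (Q : H →L[ℂ] H) : H →L[ℂ] H :=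
  cfc (fun x : ℝ => (1 + x) ^ (1 + x)) Q - 1

/-- `FEN_+(Q) = log det (I + Q)^(I + Q)`. -/
def FENplus (Q : H →L[ℂ] H) : ℝ :=
  Real.log (∏' k, (1 + eigenvalueSeq Q k) ^ (1 + eigenvalueSeq Q k))

/-- `FEN_-(Q) = log det (I + Q)^(-(I + Q))`. -/
def FENminus (Q : H →L[ℂ] H) : ℝ :=
  Real.log (∏' k, (1 + eigenvalueSeq Q k) ^ (-(1 + eigenvalueSeq Q k)))

end RenormEntropy

end

open scoped InnerProductSpace ComplexOrder

namespace RenormEntropy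

universe u

variable {H : Type u} [NormedAddCommGroup H] [InnerProductSpace ℂ H]

/-! Write `f x = (1 + x) log (1 + x)`. Since `S_+(Q)` has the eigenvectors of `Q` in the same order,
its n-th Gram number is the exponential of the n-th partial sum of `f (λ_k)`. So m-majorisation
compares these partial sums, and the limit gives the inequality of `FEN_+`; `FEN_-` is its negative.

For equality, let `a`, `b` be the two spectra, `d k = f (b k) - f (a k)` and `c k = 1 / f' (a k)`.
Strict convexity makes `c k * d k - (b k - a k)` nonnegative, and zero only if `a k = b k`. The
weights `c` increase and stay at most 1, so Abel summation bounds the partial sums of `c k * d k` by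
those of `d`, which tend to 0 when the entropies agree. Both traces are 1, so the sums of `b k - a
k` also tend to 0 and every term vanishes (`eq_of_partial_sums_le_of_tsum_eq`). -/

/-- A spectral decomposition `A = ∑ τ_n |φ_n⟩⟨φ_n|` with non-increasing nonnegative eigenvalues;
a vector `φ n` with `τ n = 0` may be zero. -/
structure IsSpectralSystem (A : H →L[ℂ] H) (φ : ℕ → H) (τ : ℕ → ℝ) : Prop where
  antitone : Antitone τ
  nonneg : ∀ n, 0 ≤ τ n
  apply_eq : ∀ n, A (φ n) = (τ n : ℂ) • φ n
  orthogonal : ∀ m n, m ≠ n → ⟪φ m, φ n⟫_ℂ = 0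
  norm_eq_one : ∀ n, ‖φ n‖ = 1 ∨ (φ n = 0 ∧ τ n = 0)
  apply_eq_zero : ∀ x, (∀ n, ⟪φ n, x⟫_ℂ = 0) → A x = 0

/-! ### Eigenvalue sequences and truncations -/

/-- Eigenvectors of a positive operator with different real eigenvalues are orthogonal. -/
theorem inner_eq_zero_of_eigenvalue_ne {A : H →L[ℂ] H} (hA : A.IsPositive) {v w : H} {s t : ℝ}
    (hv : A v = (s : ℂ) • v) (hw : A w = (t : ℂ) • w) (hst : s ≠ t) : ⟪v, w⟫_ℂ = 0 := by
  have h := hA.isSymmetric v w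
  simp only [ContinuousLinearMap.coe_coe] at h
  rw [hv, hw, inner_smul_left, inner_smul_right, Complex.conj_ofReal] at h
  have h2 : ((s : ℂ) - t) * ⟪v, w⟫_ℂ = 0 := by rw [sub_mul, h, sub_self]
  rcases mul_eq_zero.1 h2 with h3 | h3
  · exact absurd (Complex.ofReal_injective (sub_eq_zero.1 h3)) hst
  · exact h3

theorem IsEigenvectorSeq.mul_sum_rankOne {A : H →L[ℂ] H} {φ : ℕ → H}
    (h : IsEigenvectorSeq A φ) (n : ℕ) :
    A * ∑ i ∈ Finset.range n, InnerProductSpace.rankOne ℂ (φ i) (φ i) =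
      ∑ i ∈ Finset.range n,
        (eigenvalueSeq A i : ℂ) • InnerProductSpace.rankOne ℂ (φ i) (φ i) := by
  rw [Finset.mul_sum]
  refine Finset.sum_congr rfl fun i _ => ?_
  rw [ContinuousLinearMap.mul_def, InnerProductSpace.comp_rankOne, h.apply_eq, map_smul]
  rfl

/-- An eigenvector with an eigenvalue above `τ n` lies in the span of `φ 0, …, φ (n - 1)`. -/
theorem IsSpectralSystem.mem_span_of_lt {A : H →L[ℂ] H} {φ : ℕ → H} {τ : ℕ → ℝ}
    (h : IsSpectralSystem A φ τ) (hA : A.IsPositive) {n : ℕ} {v : H} {s : ℝ} (hs : τ n < s)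
    (hv : A v = (s : ℂ) • v) :
    v ∈ Submodule.span ℂ (Set.range fun k : Fin n => φ k) := by
  set p : H := ∑ k : Fin n, ⟪φ k, v⟫_ℂ • φ k with hp
  have hpmem : p ∈ Submodule.span ℂ (Set.range fun k : Fin n => φ k) :=
    Submodule.sum_mem _ fun k _ => Submodule.smul_mem _ _ (Submodule.subset_span ⟨k, rfl⟩)
  have hw : ∀ m, ⟪φ m, v - p⟫_ℂ = 0 := by
    intro m
    rw [inner_sub_right, hp, inner_sum]
    by_cases hm : m < n
    · rw [Finset.sum_eq_single (⟨m, hm⟩ : Fin n)]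
      · rcases h.norm_eq_one m with h1 | h1
        · simp [inner_smul_right, inner_self_eq_norm_sq_to_K, h1]
        · simp [h1.1]
      · intro k _ hk
        rw [inner_smul_right, h.orthogonal m k (fun e => hk (Fin.ext e.symm)), mul_zero]
      · simp
    · rw [inner_eq_zero_of_eigenvalue_ne hA (h.apply_eq m) hv
        ((h.antitone (not_lt.1 hm)).trans_lt hs).ne, zero_sub, neg_eq_zero]
      refine Finset.sum_eq_zero fun k _ => ?_
      rw [inner_smul_right, h.orthogonal m k (by omega), mul_zero]
  -- The remainder lies in the kernel of `A`, hence is orthogonal to the range, which contains `v`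
  -- because `s ≠ 0`.
  have hA0 : A (v - p) = 0 := h.apply_eq_zero _ hw
  have hwp : ⟪v - p, p⟫_ℂ = 0 := by
    refine (congrArg (fun y => ⟪v - p, y⟫_ℂ) hp).trans ((inner_sum _ _ _).trans ?_)
    refine Finset.sum_eq_zero fun k _ => ?_
    rw [inner_smul_right, inner_eq_zero_symm.1 (hw k), mul_zero]
  have hAp : ⟪v - p, A p⟫_ℂ = 0 := by
    have := hA.isSymmetric (v - p) p
    simp only [ContinuousLinearMap.coe_coe] at this
    rw [← this, hA0, inner_zero_left]
  have hAv : ⟪v - p, A v⟫_ℂ = 0 := by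
    have := hA.isSymmetric (v - p) v
    simp only [ContinuousLinearMap.coe_coe] at this
    rw [← this, hA0, inner_zero_left]
  have hs0 : (s : ℂ) ≠ 0 := Complex.ofReal_ne_zero.2 ((h.nonneg n).trans_lt hs).ne'
  have hvv : ⟪v - p, v⟫_ℂ = 0 := by
    rw [hv, inner_smul_right] at hAv
    exact (mul_eq_zero.1 hAv).resolve_left hs0
  have : v - p = 0 := by
    rw [← inner_self_eq_zero (𝕜 := ℂ), inner_sub_right, hvv, hwp, sub_zero]
  rw [sub_eq_zero.1 this]
  exact hpmem

/-- A value above `τ n` would put `n + 1` independent vectors into the span of `n` vectors.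
Conversely, `φ 0, …, φ n` attain `τ n` when it is positive. -/
theorem IsSpectralSystem.eigenvalueSeq_eq {A : H →L[ℂ] H} {φ : ℕ → H} {τ : ℕ → ℝ}
    (h : IsSpectralSystem A φ τ) (hA : A.IsPositive) : eigenvalueSeq A = τ := by
  funext n
  have hub : ∀ t ∈ {t : ℝ | ∃ v : Fin (n + 1) → H, Orthonormal ℂ v ∧
      ∀ i, ∃ s : ℝ, t ≤ s ∧ A (v i) = (s : ℂ) • v i}, t ≤ τ n := by
    rintro t ⟨v, hv, hvs⟩
    by_contra! hlt
    have hmem : ∀ i, v i ∈ Submodule.span ℂ (Set.range fun k : Fin n => φ k) := by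
      intro i
      obtain ⟨s, hts, hs⟩ := hvs i
      exact h.mem_span_of_lt hA (hlt.trans_le hts) hs
    have hli : LinearIndependent ℂ
        (fun i => (⟨v i, hmem i⟩ : Submodule.span ℂ (Set.range fun k : Fin n => φ k))) :=
      LinearIndependent.of_comp (Submodule.subtype _) hv.linearIndependent
    have : FiniteDimensional ℂ (Submodule.span ℂ (Set.range fun k : Fin n => φ k)) :=
      FiniteDimensional.span_of_finite ℂ (Set.finite_range _)
    have h1 := hli.fintype_card_le_finrank
    have h2 : Module.finrank ℂ (Submodule.span ℂ (Set.range fun k : Fin n => φ k)) ≤ n := by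
      simpa [Set.finrank] using finrank_range_le_card (R := ℂ) (fun k : Fin n => φ k)
    simp at h1
    omega
  refine le_antisymm ?_ ?_
  · rw [eigenvalueSeq]
    rcases Set.eq_empty_or_nonempty {t : ℝ | ∃ v : Fin (n + 1) → H, Orthonormal ℂ v ∧
      ∀ i, ∃ s : ℝ, t ≤ s ∧ A (v i) = (s : ℂ) • v i} with he | hne
    · rw [he, Real.sSup_empty]
      exact h.nonneg n
    · exact csSup_le hne hub
  · rcases (h.nonneg n).lt_or_eq with hpos | hzero
    · refine le_csSup ⟨_, hub⟩ ⟨fun k => φ k, ⟨fun k => ?_, fun j k hjk => ?_⟩, fun k => ?_⟩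
      · exact (h.norm_eq_one k).resolve_right fun h0 =>
          (hpos.trans_le (h.antitone (Nat.lt_succ_iff.1 k.2))).ne' h0.2
      · exact h.orthogonal _ _ fun e => hjk (Fin.ext e)
      · exact ⟨τ k, h.antitone (Nat.lt_succ_iff.1 k.2), h.apply_eq k⟩
    · rw [← hzero]
      -- If `τ n = 0`, some `φ k` may be zero. Either the set is empty and its `sSup` is 0, or
      -- positivity of `A` puts 0 into it.
      rcases Set.eq_empty_or_nonempty {t : ℝ | ∃ v : Fin (n + 1) → H, Orthonormal ℂ v ∧
        ∀ i, ∃ s : ℝ, t ≤ s ∧ A (v i) = (s : ℂ) • v i} with he | ⟨t, v, hv, hvs⟩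
      · rw [eigenvalueSeq, he, Real.sSup_empty]
      · refine le_csSup ⟨_, hub⟩ ⟨v, hv, fun i => ?_⟩
        obtain ⟨s, -, hs⟩ := hvs i
        refine ⟨s, ?_, hs⟩
        have h0 := hA.inner_nonneg_right (v i)
        rw [hs, inner_smul_right, inner_self_eq_norm_sq_to_K, hv.1 i] at h0
        simpa using h0

theorem IsSpectralSystem.isEigenvectorSeq {A : H →L[ℂ] H} {φ : ℕ → H} {τ : ℕ → ℝ}
    (h : IsSpectralSystem A φ τ) (hA : A.IsPositive) : IsEigenvectorSeq A φ where
  apply_eq := by rw [h.eigenvalueSeq_eq hA]; exact h.apply_eq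
  orthogonal := h.orthogonal
  norm_eq_one := by rw [h.eigenvalueSeq_eq hA]; exact h.norm_eq_one

/-- The truncation of a spectral decomposition. -/
theorem IsEigenvectorSeq.isSpectralSystem_truncation {A : H →L[ℂ] H} {φ : ℕ → H}
    (h : IsEigenvectorSeq A φ) (hanti : Antitone (eigenvalueSeq A))
    (hnn : ∀ k, 0 ≤ eigenvalueSeq A k) (n : ℕ) :
    IsSpectralSystem (A * ∑ i ∈ Finset.range n, InnerProductSpace.rankOne ℂ (φ i) (φ i))
      (fun k => if k < n then φ k else 0) (fun k => if k < n then eigenvalueSeq A k else 0) := by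
  rw [h.mul_sum_rankOne]
  refine ⟨fun j k hjk => ?_, fun k => ?_, fun k => ?_, fun j k hjk => ?_, fun k => ?_,
    fun x hx => ?_⟩
  · split_ifs with h1 h2
    · exact hanti hjk
    · omega
    · exact hnn j
    · exact le_rfl
  · split_ifs
    exacts [hnn k, le_rfl]
  · split_ifs with hk
    · rw [sum_apply, Finset.sum_eq_single_of_mem k (Finset.mem_range.2 hk)]
      · rcases h.norm_eq_one k with h1 | h1
        · simp [inner_self_eq_norm_sq_to_K, h1]
        · simp [h1.1]
      · intro i _ hik
        simp [h.orthogonal i k hik]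
    · simp
  · split_ifs <;> simp [h.orthogonal j k hjk]
  · split_ifs
    exacts [h.norm_eq_one k, Or.inr ⟨rfl, rfl⟩]
  · rw [sum_apply]
    refine Finset.sum_eq_zero fun i hi => ?_
    have := hx i
    rw [if_pos (Finset.mem_range.1 hi)] at this
    simp [this]

/-- Positivity lets the absolute value in `singularValueSeq` be dropped. -/
theorem IsEigenvectorSeq.isPositive_truncation {A : H →L[ℂ] H} {φ : ℕ → H}
    (h : IsEigenvectorSeq A φ) (hnn : ∀ k, 0 ≤ eigenvalueSeq A k) (n : ℕ) :
    (A * ∑ i ∈ Finset.range n, InnerProductSpace.rankOne ℂ (φ i) (φ i)).IsPositive := by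
  rw [h.mul_sum_rankOne]
  refine ContinuousLinearMap.isPositive_sum _ fun i _ => ?_
  exact (InnerProductSpace.isPositive_rankOne_self (φ i)).smul_of_nonneg
    (Complex.zero_le_real.2 (hnn i))

/-! ### Entropies as series -/

theorem FENplus_eq_tsum {Q : H →L[ℂ] H} (h0 : ∀ n, 0 ≤ eigenvalueSeq Q n)
    (hs : Summable fun k => (1 + eigenvalueSeq Q k) * Real.log (1 + eigenvalueSeq Q k)) :
    FENplus Q = ∑' k, (1 + eigenvalueSeq Q k) * Real.log (1 + eigenvalueSeq Q k) := by
  have hpos : ∀ k, 0 < 1 + eigenvalueSeq Q k := fun k => by linarith [h0 k]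
  have hlog : ∀ k, Real.log ((1 + eigenvalueSeq Q k) ^ (1 + eigenvalueSeq Q k)) =
      (1 + eigenvalueSeq Q k) * Real.log (1 + eigenvalueSeq Q k) :=
    fun k => Real.log_rpow (hpos k) _
  rw [FENplus, ← Real.rexp_tsum_eq_tprod (fun k => Real.rpow_pos_of_pos (hpos k) _)
    (hs.congr fun k => (hlog k).symm), Real.log_exp]
  exact tsum_congr hlog

theorem FENminus_eq_neg_FENplus {Q : H →L[ℂ] H} (h0 : ∀ n, 0 ≤ eigenvalueSeq Q n)
    (hs : Summable fun k => (1 + eigenvalueSeq Q k) * Real.log (1 + eigenvalueSeq Q k)) :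
    FENminus Q = -FENplus Q := by
  have hpos : ∀ k, 0 < 1 + eigenvalueSeq Q k := fun k => by linarith [h0 k]
  have hlog : ∀ k, Real.log ((1 + eigenvalueSeq Q k) ^ (-(1 + eigenvalueSeq Q k))) =
      -((1 + eigenvalueSeq Q k) * Real.log (1 + eigenvalueSeq Q k)) :=
    fun k => by rw [Real.log_rpow (hpos k), neg_mul]
  rw [FENplus_eq_tsum h0 hs, FENminus,
    ← Real.rexp_tsum_eq_tprod (fun k => Real.rpow_pos_of_pos (hpos k) _)
      (hs.neg.congr fun k => (hlog k).symm), Real.log_exp, ← tsum_neg]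
  exact tsum_congr hlog

variable [CompleteSpace H]

/-! ### Compactness and spectral decomposition of states -/

/-- A Hilbert-Schmidt operator is compact. -/
theorem isCompactOperator_of_summable_norm_sq {ι : Type*} (b : HilbertBasis ι ℂ H) (T : H →L[ℂ] H)
    (hT : Summable fun i => ‖T (b i)‖ ^ 2) : IsCompactOperator T := by
  set R : ι → H →L[ℂ] H := fun i => InnerProductSpace.rankOne ℂ (T (b i)) (b i) with hR
  -- Cauchy-Schwarz and Bessel; this makes the rank-one expansion converge in operator norm.
  have hbound : ∀ s : Finset ι, ‖∑ i ∈ s, R i‖ ≤ √(∑ i ∈ s, ‖T (b i)‖ ^ 2) := by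
    intro s
    refine ContinuousLinearMap.opNorm_le_bound _ (Real.sqrt_nonneg _) fun x => ?_
    have h1 : ‖(∑ i ∈ s, R i) x‖ ≤ ∑ i ∈ s, ‖T (b i)‖ * ‖⟪b i, x⟫_ℂ‖ := by
      rw [sum_apply]
      refine (norm_sum_le _ _).trans (Finset.sum_le_sum fun i _ => ?_)
      rw [hR, InnerProductSpace.rankOne_apply, norm_smul, mul_comm]
    refine h1.trans ?_
    rw [← Real.sqrt_sq (norm_nonneg x), ← Real.sqrt_mul (Finset.sum_nonneg fun i _ => sq_nonneg _)]
    refine Real.le_sqrt_of_sq_le ((Finset.sum_mul_sq_le_sq_mul_sq s _ _).trans ?_)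
    exact mul_le_mul_of_nonneg_left (b.orthonormal.sum_inner_products_le x)
      (Finset.sum_nonneg fun i _ => sq_nonneg _)
  have hsum : Summable R := by
    rw [summable_iff_vanishing_norm]
    intro ε hε
    obtain ⟨s, hs⟩ := summable_iff_vanishing_norm.1 hT (ε ^ 2) (by positivity)
    refine ⟨s, fun t ht => (hbound t).trans_lt ?_⟩
    rw [Real.sqrt_lt' hε]
    exact (le_abs_self _).trans_lt (hs t ht)
  have hTR : ∑' i, R i = T := by
    ext x
    have h1 : HasSum (fun i => R i x) ((∑' i, R i) x) :=
      hsum.hasSum.mapL (ContinuousLinearMap.apply ℂ H x : (H →L[ℂ] H) →L[ℂ] H)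
    have h2 : HasSum (fun i => R i x) (T x) := by
      convert T.hasSum (b.hasSum_repr x) using 2 with i
      rw [hR, InnerProductSpace.rankOne_apply, map_smul, b.repr_apply_apply]
    exact h1.unique h2
  have hlim : Filter.Tendsto (fun s : Finset ι => ∑ i ∈ s, R i) Filter.atTop (nhds T) := by
    rw [← hTR]
    exact hsum.hasSum
  refine isCompactOperator_of_tendsto hlim (Filter.Eventually.of_forall fun s => ?_)
  refine (compactOperator (RingHom.id ℂ) H H).sum_mem fun i _ => ?_
  have h1 : IsCompactOperator (innerSL ℂ (b i)) :=
    isCompactOperator_of_locallyCompactSpace_dom (innerSL ℂ (b i))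
  exact h1.clm_comp (ContinuousLinearMap.toSpanSingleton ℂ (T (b i)))

/-- The square root of `Q` is Hilbert-Schmidt, because its squared norms on a basis sum to the trace
of `Q`. -/
theorem IsState.isCompactOperator {Q : H →L[ℂ] H} (hQ : IsState Q) : IsCompactOperator Q := by
  obtain ⟨w, b, -⟩ := exists_hilbertBasis ℂ H
  have hQ0 : 0 ≤ Q := (ContinuousLinearMap.nonneg_iff_isPositive Q).2 hQ.isPositive
  have hsq : CFC.sqrt Q * CFC.sqrt Q = Q := CFC.sqrt_mul_sqrt_self Q hQ0
  have hsym := ((ContinuousLinearMap.nonneg_iff_isPositive _).1 (CFC.sqrt_nonneg Q)).isSymmetric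
  have hT : Summable fun i => ‖CFC.sqrt Q (b i)‖ ^ 2 := by
    have h1 := (Complex.hasSum_re (hQ.hasTrace_one b)).summable
    refine h1.congr fun i => ?_
    have h2 := hsym (b i) (CFC.sqrt Q (b i))
    simp only [ContinuousLinearMap.coe_coe] at h2
    have h3 : Q (b i) = CFC.sqrt Q (CFC.sqrt Q (b i)) := by
      rw [← mul_apply_eq_comp, hsq]
    rw [h3, ← h2, inner_self_eq_norm_sq_to_K]
    norm_cast
  have hc := (isCompactOperator_of_summable_norm_sq b _ hT).clm_comp (CFC.sqrt Q)
  rw [← hsq]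
  exact hc

/-- The Hilbert-Schmidt theorem: a compact positive operator has a Hilbert basis of eigenvectors. -/
theorem exists_hilbertBasis_eigenvectors {A : H →L[ℂ] H} (hA : A.IsPositive)
    (hc : IsCompactOperator A) :
    ∃ (ι : Type u) (b : HilbertBasis ι ℂ H) (w : ι → ℝ), (∀ i, 0 ≤ w i) ∧
      ∀ i, A (b i) = (w i : ℂ) • b i := by
  have hS := hA.isSymmetric
  let E : ℂ → Submodule ℂ H := fun μ => Module.End.eigenspace (A : H →ₗ[ℂ] H) μ
  have hclosed : ∀ μ, IsClosed (E μ : Set H) := by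
    intro μ
    have : (E μ : Set H) = {x | A x = μ • x} := by
      ext x
      simp [E]
    rw [this]
    exact isClosed_eq A.continuous (continuous_const_smul μ)
  have : ∀ μ, CompleteSpace (E μ) := fun μ => (hclosed μ).completeSpace_coe
  choose s c hsc using fun μ => exists_hilbertBasis ℂ (E μ)
  have hort : Orthonormal ℂ fun a : Σ μ, s μ => ((c a.1 a.2 : E a.1) : H) :=
    hS.orthogonalFamily_eigenspaces.orthonormal_sigma_orthonormal fun μ => (c μ).orthonormal
  have hbot : (Submodule.span ℂ (Set.range fun a : Σ μ, s μ => ((c a.1 a.2 : E a.1) : H)))ᗮ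
      = ⊥ := by
    rw [eq_bot_iff, ← ContinuousLinearMap.orthogonalComplement_iSup_eigenspaces_eq_bot hc hS]
    intro x hx
    rw [Submodule.mem_orthogonal] at hx ⊢
    intro y hy
    refine Submodule.iSup_induction _ (motive := fun y => ⟪y, x⟫_ℂ = 0) hy ?_ (inner_zero_left _)
      fun y z hy hz => by rw [inner_add_left, hy, hz, add_zero]
    intro μ y hy
    have h1 := (c μ).hasSum_repr ⟨y, hy⟩
    have h2 := ((innerSL ℂ x).comp (E μ).subtypeL).hasSum h1
    have h3 : HasSum (fun _ : s μ => (0 : ℂ)) ⟪x, y⟫_ℂ := by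
      refine h2.congr_fun fun i => ?_
      have h4 := hx (c μ i : E μ) (Submodule.subset_span ⟨⟨μ, i⟩, rfl⟩)
      have h5 : ⟪x, ((c μ i : E μ) : H)⟫_ℂ = 0 := by rw [← inner_conj_symm, h4, map_zero]
      simp [h5]
    rw [← inner_conj_symm, h3.unique hasSum_zero, map_zero]
  have hev : ∀ a : Σ μ, s μ, A (c a.1 a.2 : E a.1) = a.1 • ((c a.1 a.2 : E a.1) : H) :=
    fun a => Module.End.mem_eigenspace_iff.1 (c a.1 a.2 : E a.1).2
  have hnn : ∀ a : Σ μ, s μ, 0 ≤ a.1 := by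
    intro a
    have h0 := hA.inner_nonneg_right ((c a.1 a.2 : E a.1) : H)
    rw [hev, inner_smul_right, inner_self_eq_norm_sq_to_K, hort.1 a] at h0
    simpa using h0
  refine ⟨Σ μ, s μ, HilbertBasis.mkOfOrthogonalEqBot hort hbot, fun a => a.1.re,
    fun a => (Complex.le_def.1 (hnn a)).1, fun a => ?_⟩
  rw [HilbertBasis.coe_mkOfOrthogonalEqBot, hev, ← Complex.eq_re_of_ofReal_le (hnn a)]

/-- A nonnegative family on an infinite type with finite superlevel sets can be enumerated in
non-increasing order, up to indices where it vanishes. -/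
theorem exists_antitone_enumeration {J : Type*} [Infinite J] (w : J → ℝ) (hw : ∀ j, 0 ≤ w j)
    (hfin : ∀ ε > 0, {j | ε ≤ w j}.Finite) :
    ∃ e : ℕ → J, Function.Injective e ∧ Antitone (w ∘ e) ∧ ∀ j, 0 < w j → j ∈ Set.range e := by
  classical
  -- Greedy choice: outside any finite set the weight has a maximum.
  have hpick : ∀ F : Finset J, ∃ j, j ∉ F ∧ ∀ i ∉ F, w i ≤ w j := by
    intro F
    by_cases h : ∃ j ∉ F, 0 < w j
    · obtain ⟨j, hj, hpos⟩ := h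
      have hf : ({i | w j ≤ w i} \ (F : Set J)).Finite := (hfin _ hpos).sdiff
      obtain ⟨m, hm, hmax⟩ := Set.exists_max_image _ w hf ⟨j, le_refl (w j), hj⟩
      refine ⟨m, hm.2, fun i hi => ?_⟩
      by_cases hij : w j ≤ w i
      · exact hmax i ⟨hij, hi⟩
      · exact (not_le.1 hij).le.trans hm.1
    · push Not at h
      obtain ⟨j, hj⟩ := Infinite.exists_notMem_finset F
      exact ⟨j, hj, fun i hi => (h i hi).trans (hw j)⟩
  choose pick hpick1 hpick2 using hpick
  let F : ℕ → Finset J := fun n => Nat.rec ∅ (fun _ G => insert (pick G) G) n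
  have hF : ∀ n, F (n + 1) = insert (pick (F n)) (F n) := fun n => rfl
  have hmono : Monotone F := monotone_nat_of_le_succ fun n => by
    rw [hF]; exact Finset.subset_insert _ _
  have hmem : ∀ m n, m < n → pick (F m) ∈ F n := fun m n hmn =>
    hmono (Nat.succ_le_of_lt hmn) (by rw [Nat.succ_eq_add_one, hF]; exact Finset.mem_insert_self _ _)
  have hFr : ∀ n, ∀ j ∈ F n, ∃ m, pick (F m) = j := by
    intro n
    induction n with
    | zero => intro j hj; simp [F] at hj
    | succ n ih =>
      intro j hj
      rw [hF, Finset.mem_insert] at hj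
      rcases hj with rfl | hj
      · exact ⟨n, rfl⟩
      · exact ih j hj
  have hinj : Function.Injective fun n => pick (F n) := by
    intro m n e
    have key : ∀ m n, m < n → pick (F m) ≠ pick (F n) := fun m n hmn h =>
      hpick1 (F n) (by rw [← h]; exact hmem m n hmn)
    by_contra hne
    exact (lt_or_gt_of_ne hne).elim (fun h => key m n h e) fun h => key n m h e.symm
  refine ⟨fun n => pick (F n), hinj, ?_, ?_⟩
  · exact antitone_nat_of_succ_le fun n =>
      hpick2 (F n) _ fun h => hpick1 (F (n + 1)) (hmono n.le_succ h)
  · intro j hj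
    by_contra hnot
    have hle : ∀ n, w j ≤ w (pick (F n)) := fun n =>
      hpick2 (F n) j fun h => hnot (hFr n j h)
    exact Set.infinite_range_of_injective hinj
      ((hfin _ hj).subset (by rintro _ ⟨n, rfl⟩; exact hle n))

/-- The spectral decomposition of a quantum state. -/
theorem IsState.exists_isSpectralSystem {Q : H →L[ℂ] H} (hQ : IsState Q) :
    ∃ (φ : ℕ → H) (τ : ℕ → ℝ), IsSpectralSystem Q φ τ ∧ HasSum τ 1 := by
  obtain ⟨ι, b, w, hw, hb⟩ := exists_hilbertBasis_eigenvectors hQ.isPositive hQ.isCompactOperator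
  have hsum : HasSum w 1 := by
    have h := Complex.hasSum_re (hQ.hasTrace_one b)
    rw [Complex.one_re] at h
    refine h.congr_fun fun i => ?_
    rw [hb, inner_smul_right, inner_self_eq_norm_sq_to_K, b.orthonormal.1 i]
    simp
  -- Padding by zero vectors of weight 0 makes the index type infinite, also in finite dimension.
  let w' : ι ⊕ ℕ → ℝ := Sum.elim w fun _ => 0
  let b' : ι ⊕ ℕ → H := Sum.elim b fun _ => 0
  have hsum' : HasSum w' 1 := by
    refine (Sum.inl_injective.hasSum_iff fun x hx => ?_).1 hsum
    rcases x with i | k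
    · exact absurd ⟨i, rfl⟩ hx
    · rfl
  have hw' : ∀ j, 0 ≤ w' j := by
    rintro (i | k)
    · exact hw i
    · exact le_rfl
  have hfin : ∀ ε > 0, {j | ε ≤ w' j}.Finite := by
    intro ε hε
    have := hsum'.summable.tendsto_cofinite_zero.eventually_lt_const hε
    simpa [Filter.eventually_cofinite] using this
  obtain ⟨e, hinj, hanti, hrange⟩ := exists_antitone_enumeration w' hw' hfin
  have hzero : ∀ j ∉ Set.range e, w' j = 0 := fun j hj =>
    le_antisymm (not_lt.1 fun h => hj (hrange j h)) (hw' j)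
  refine ⟨b' ∘ e, w' ∘ e, ⟨hanti, fun n => hw' _, fun n => ?_, fun m n hmn => ?_, fun n => ?_,
    fun x hx => ?_⟩, (hinj.hasSum_iff hzero).2 hsum'⟩
  · simp only [Function.comp_apply]
    rcases e n with i | k
    · exact hb i
    · simp [b']
  · have hne := hinj.ne hmn
    simp only [Function.comp_apply]
    rcases hm : e m with i | k <;> rcases hn : e n with j | l
    · exact b.orthonormal.2 fun h => hne (by rw [hm, hn, h])
    all_goals simp [b']
  · simp only [Function.comp_apply]
    rcases e n with i | k
    · exact Or.inl (b.orthonormal.1 i)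
    · exact Or.inr ⟨rfl, rfl⟩
  · have h1 := Q.hasSum (b.hasSum_repr x)
    have h2 : HasSum (fun _ : ι => (0 : H)) (Q x) := by
      convert h1 using 1
      funext i
      rw [map_smul, hb, b.repr_apply_apply]
      -- Basis vectors missed by the enumeration have eigenvalue 0.
      by_cases hi : Sum.inl i ∈ Set.range e
      · obtain ⟨n, hn⟩ := hi
        have := hx n
        simp only [Function.comp_apply, hn] at this
        rw [show ⟪b i, x⟫_ℂ = 0 from this, zero_smul]
      · rw [show w i = 0 from hzero _ hi, Complex.ofReal_zero, zero_smul, smul_zero]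
    exact h2.unique hasSum_zero

/-! ### The entropy-generating operator and its Gram numbers -/

/-- Functional calculus acts on eigenvectors by applying the function to the eigenvalue. -/
theorem cfc_apply_eigenvector {A : H →L[ℂ] H} (hA : IsSelfAdjoint A) {f : ℝ → ℝ} {U : Set ℝ}
    (hU : spectrum ℝ A ⊆ U) (hf : ContinuousOn f U) {t : ℝ} (ht : U ∈ nhds t)
    (hft : DifferentiableAt ℝ f t) {v : H} (hv : A v = (t : ℂ) • v) :
    cfc f A v = (f t : ℂ) • v := by
  have hg : ContinuousOn (dslope f t) (spectrum ℝ A) :=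
    ((continuousOn_dslope ht).2 ⟨hf, hft⟩).mono hU
  -- In `f x = f t + dslope f t x * (x - t)` the last factor becomes `A - t`, which annihilates `v`.
  have h1 : f = fun x => f t + dslope f t x * (x - t) := by
    funext x
    have := sub_smul_dslope f t x
    rw [smul_eq_mul] at this
    linarith
  have h2 : cfc f A = algebraMap ℝ (H →L[ℂ] H) (f t) +
      cfc (dslope f t) A * (A - algebraMap ℝ (H →L[ℂ] H) t) := by
    conv_lhs => rw [h1]
    rw [cfc_const_add (f t) (fun x => dslope f t x * (x - t)) A (by fun_prop) hA,
      cfc_mul (dslope f t) (fun x => x - t) A hg (by fun_prop),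
      cfc_sub (fun x => x) (fun _ => t) A (by fun_prop) (by fun_prop), cfc_id' ℝ A hA,
      cfc_const t A hA]
  have h3 : ∀ r : ℝ, algebraMap ℝ (H →L[ℂ] H) r v = (r : ℂ) • v := fun r => by
    rw [Algebra.algebraMap_eq_smul_one]
    simp
  rw [h2]
  simp [h3, hv]

theorem IsState.spectrum_subset {Q : H →L[ℂ] H} (hQ : IsState Q) :
    spectrum ℝ Q ⊆ Set.Ioi (-1) := fun _ hx =>
  neg_one_lt_zero.trans_le
    (spectrum_nonneg_of_nonneg ((ContinuousLinearMap.nonneg_iff_isPositive Q).2 hQ.isPositive) hx)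

theorem differentiableAt_one_add_rpow_self {t : ℝ} (ht : -1 < t) :
    DifferentiableAt ℝ (fun x : ℝ => (1 + x) ^ (1 + x)) t := by
  have h : (1 : ℝ) + t ≠ 0 := by linarith
  exact ((differentiableAt_const _).add differentiableAt_id).rpow
    ((differentiableAt_const _).add differentiableAt_id) h

theorem continuousOn_one_add_rpow_self :
    ContinuousOn (fun x : ℝ => (1 + x) ^ (1 + x)) (Set.Ioi (-1)) := fun _ hx =>
  (differentiableAt_one_add_rpow_self hx).continuousAt.continuousWithinAt

theorem one_le_one_add_rpow_self {x : ℝ} (hx : 0 ≤ x) : 1 ≤ (1 + x) ^ (1 + x) :=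
  Real.one_le_rpow (by linarith) (by linarith)

theorem IsState.isPositive_entropyOpPlus {Q : H →L[ℂ] H} (hQ : IsState Q) :
    (entropyOpPlus Q).IsPositive := by
  rw [← ContinuousLinearMap.nonneg_iff_isPositive, entropyOpPlus, sub_nonneg]
  have hQ0 := (ContinuousLinearMap.nonneg_iff_isPositive Q).2 hQ.isPositive
  rw [← cfc_const_one ℝ Q hQ.isPositive.isSelfAdjoint]
  exact cfc_mono (fun x hx => one_le_one_add_rpow_self (spectrum_nonneg_of_nonneg hQ0 hx))
    (by fun_prop) (continuousOn_one_add_rpow_self.mono hQ.spectrum_subset)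

theorem IsState.isSpectralSystem_entropyOpPlus {Q : H →L[ℂ] H} (hQ : IsState Q) {φ : ℕ → H}
    {τ : ℕ → ℝ} (h : IsSpectralSystem Q φ τ) :
    IsSpectralSystem (entropyOpPlus Q) φ fun n => (1 + τ n) ^ (1 + τ n) - 1 := by
  have key : ∀ (t : ℝ) (v : H), 0 ≤ t → Q v = (t : ℂ) • v →
      entropyOpPlus Q v = (((1 + t) ^ (1 + t) - 1 : ℝ) : ℂ) • v := fun t v ht hv => by
    have ht' : -1 < t := by linarith
    have := cfc_apply_eigenvector hQ.isPositive.isSelfAdjoint hQ.spectrum_subset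
      continuousOn_one_add_rpow_self (Ioi_mem_nhds ht') (differentiableAt_one_add_rpow_self ht') hv
    rw [entropyOpPlus, sub_apply, this, Complex.ofReal_sub, sub_smul]
    simp
  refine ⟨fun m n hmn => ?_, fun n => sub_nonneg.2 (one_le_one_add_rpow_self (h.nonneg n)),
    fun n => key _ _ (h.nonneg n) (h.apply_eq n), h.orthogonal, fun n => ?_, fun x hx => ?_⟩
  · have hn := h.nonneg n
    have hle := h.antitone hmn
    have h1 : (1 + τ n) ^ (1 + τ n) ≤ (1 + τ m) ^ (1 + τ n) :=
      Real.rpow_le_rpow (by linarith) (by linarith) (by linarith)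
    have h2 : (1 + τ m) ^ (1 + τ n) ≤ (1 + τ m) ^ (1 + τ m) :=
      Real.rpow_le_rpow_of_exponent_le (by linarith) (by linarith)
    simpa using h1.trans h2
  · exact (h.norm_eq_one n).imp_right fun h0 => ⟨h0.1, by simp [h0.2]⟩
  -- Such an `x` is in the kernel of `Q`, and `(1 + 0) ^ (1 + 0) - 1 = 0`.
  · rw [key 0 x le_rfl (by rw [h.apply_eq_zero x hx]; simp)]
    simp

/-- Gram numbers are finite products over the eigenvalues. -/
theorem IsSpectralSystem.gramNumber_eq {A : H →L[ℂ] H} {φ : ℕ → H} {τ : ℕ → ℝ}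
    (h : IsSpectralSystem A φ τ) (hA : A.IsPositive) (n : ℕ) :
    gramNumber A n = ∏ k ∈ Finset.range n, (1 + τ k) := by
  have hev := h.eigenvalueSeq_eq hA
  have hex : ∃ φ : ℕ → H, IsEigenvectorSeq A φ := ⟨φ, h.isEigenvectorSeq hA⟩
  have hnn : ∀ k, 0 ≤ eigenvalueSeq A k := by rw [hev]; exact h.nonneg
  -- The eigenvectors chosen in `spectralProj` need not be `φ`; only their eigenvalues enter.
  have hpos := hex.choose_spec.isPositive_truncation hnn n
  have hsys := hex.choose_spec.isSpectralSystem_truncation (by rw [hev]; exact h.antitone) hnn n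
  rw [gramNumber, spectralProj, dif_pos hex, fredholmDet, singularValueSeq,
    CFC.abs_of_nonneg _ ((ContinuousLinearMap.nonneg_iff_isPositive _).2 hpos),
    hsys.eigenvalueSeq_eq hpos, hev, tprod_eq_prod (s := Finset.range n)]
  · exact Finset.prod_congr rfl fun k hk => by simp [Finset.mem_range.1 hk]
  · intro k hk
    simp [mt Finset.mem_range.2 hk]

/-! ### Convexity and the equality case -/

/-- The function `x ↦ (1 + x) log (1 + x)` lies strictly above its tangents. -/
theorem tangent_lt_one_add_mul_log {x y : ℝ} (hx : 0 ≤ x) (hy : 0 ≤ y) (hxy : x ≠ y) :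
    (1 + Real.log (1 + x)) * (y - x) <
      (1 + y) * Real.log (1 + y) - (1 + x) * Real.log (1 + x) := by
  have hx1 : 0 < 1 + x := by linarith
  have hy1 : 0 < 1 + y := by linarith
  have h1 : (1 + x) / (1 + y) ≠ 1 := by
    rw [Ne, div_eq_one_iff_eq hy1.ne']
    exact fun h => hxy (add_left_cancel h)
  -- The tangent inequality is `log u < u - 1` at `u = (1 + x) / (1 + y)`, multiplied by `1 + y`.
  have h2 := Real.log_lt_sub_one_of_pos (div_pos hx1 hy1) h1
  rw [Real.log_div hx1.ne' hy1.ne'] at h2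
  have h3 := mul_lt_mul_of_pos_left h2 hy1
  have h4 : (1 + y) * ((1 + x) / (1 + y) - 1) = x - y := by
    field_simp
    ring
  rw [h4] at h3
  linarith

/-- Abel summation with non-decreasing weights and nonnegative partial sums. -/
theorem sum_mul_le_of_partial_sums_nonneg {c d : ℕ → ℝ} (hc : Monotone c)
    (hd : ∀ n, 0 ≤ ∑ k ∈ Finset.range n, d k) (n : ℕ) :
    ∑ k ∈ Finset.range n, c k * d k ≤ c n * ∑ k ∈ Finset.range n, d k := by
  induction n with
  | zero => simp
  | succ n ih =>
    calc ∑ k ∈ Finset.range (n + 1), c k * d k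
        ≤ c n * ∑ k ∈ Finset.range n, d k + c n * d n := by
          rw [Finset.sum_range_succ]
          linarith
      _ = c n * ∑ k ∈ Finset.range (n + 1), d k := by rw [Finset.sum_range_succ, mul_add]
      _ ≤ _ := mul_le_mul_of_nonneg_right (hc n.le_succ) (hd _)

/-- The equality case of majorisation for the strictly convex function `(1 + x) log (1 + x)`. -/
theorem eq_of_partial_sums_le_of_tsum_eq {a b : ℕ → ℝ} (ha : Antitone a) (ha0 : ∀ n, 0 ≤ a n)
    (hb0 : ∀ n, 0 ≤ b n) {z s : ℝ} (haz : HasSum a z) (hbz : HasSum b z)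
    (has : HasSum (fun k => (1 + a k) * Real.log (1 + a k)) s)
    (hbs : HasSum (fun k => (1 + b k) * Real.log (1 + b k)) s)
    (hle : ∀ n, ∑ k ∈ Finset.range n, (1 + a k) * Real.log (1 + a k) ≤
      ∑ k ∈ Finset.range n, (1 + b k) * Real.log (1 + b k)) : a = b := by
  set d : ℕ → ℝ := fun k => (1 + b k) * Real.log (1 + b k) - (1 + a k) * Real.log (1 + a k) with hd
  -- The reciprocal slope of the tangent at `a k`; it increases because `a` is non-increasing.
  set c : ℕ → ℝ := fun k => (1 + Real.log (1 + a k))⁻¹ with hcdef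
  have hlog : ∀ k, 0 ≤ Real.log (1 + a k) := fun k => Real.log_nonneg (by linarith [ha0 k])
  have hc1 : ∀ k, c k ≤ 1 := fun k => inv_le_one_of_one_le₀ (by linarith [hlog k])
  have hc : Monotone c := fun m n hmn =>
    inv_anti₀ (by linarith [hlog n]) (add_le_add_right
      (Real.log_le_log (by linarith [ha0 n]) (by linarith [ha hmn])) _)
  have hD : ∀ n, 0 ≤ ∑ k ∈ Finset.range n, d k := fun n => by
    rw [hd, Finset.sum_sub_distrib]
    exact sub_nonneg.2 (hle n)
  have hstep : ∀ k, a k ≠ b k → b k - a k < c k * d k := fun k hk => by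
    have h1 := tangent_lt_one_add_mul_log (ha0 k) (hb0 k) hk
    rwa [hcdef, lt_inv_mul_iff₀ (by linarith [hlog k])]
  have hnn : ∀ k, 0 ≤ c k * d k - (b k - a k) := fun k => by
    by_cases hk : a k = b k
    · simp [hd, hk]
    · exact sub_nonneg.2 (hstep k hk).le
  have hlim : Filter.Tendsto (fun n => ∑ k ∈ Finset.range n, d k -
      ∑ k ∈ Finset.range n, (b k - a k)) Filter.atTop (nhds 0) := by
    have := (hbs.sub has).tendsto_sum_nat.sub (hbz.sub haz).tendsto_sum_nat
    simpa [hd] using this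
  funext k
  by_contra hk
  have hpos : 0 < c k * d k - (b k - a k) := sub_pos.2 (hstep k hk)
  -- A single positive term would bound from below partial sums whose upper bound tends to 0.
  refine hpos.not_ge (ge_of_tendsto hlim (Filter.eventually_atTop.2 ⟨k + 1, fun n hn => ?_⟩))
  calc c k * d k - (b k - a k)
      ≤ ∑ j ∈ Finset.range n, (c j * d j - (b j - a j)) :=
        Finset.single_le_sum (f := fun j => c j * d j - (b j - a j)) (fun j _ => hnn j)
          (Finset.mem_range.2 hn)
    _ = ∑ j ∈ Finset.range n, c j * d j - ∑ j ∈ Finset.range n, (b j - a j) :=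
        Finset.sum_sub_distrib _ _
    _ ≤ _ := by
        refine sub_le_sub_right ((sum_mul_le_of_partial_sums_nonneg hc hD n).trans ?_) _
        exact mul_le_of_le_one_left (hD n) (hc1 n)

theorem IsState.exists_eigenvalueSeq {Q : H →L[ℂ] H} (hQ : IsState Q) :
    Antitone (eigenvalueSeq Q) ∧ (∀ n, 0 ≤ eigenvalueSeq Q n) ∧ HasSum (eigenvalueSeq Q) 1 ∧
      ∀ n, gramNumber (entropyOpPlus Q) n =
        ∏ k ∈ Finset.range n, (1 + eigenvalueSeq Q k) ^ (1 + eigenvalueSeq Q k) := by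
  obtain ⟨φ, τ, h, hsum⟩ := hQ.exists_isSpectralSystem
  rw [h.eigenvalueSeq_eq hQ.isPositive]
  refine ⟨h.antitone, h.nonneg, hsum, fun n => ?_⟩
  rw [(hQ.isSpectralSystem_entropyOpPlus h).gramNumber_eq hQ.isPositive_entropyOpPlus]
  simp

/-- Each `a k` is at most the total sum, so the terms are dominated by a multiple of `log (1 + a
k)`. -/
theorem summable_one_add_mul_log {a : ℕ → ℝ} (ha0 : ∀ n, 0 ≤ a n) (ha : Summable a) :
    Summable fun k => (1 + a k) * Real.log (1 + a k) := by
  have hlog := Real.summable_log_one_add_of_summable ha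
  have hbd : ∀ k, a k ≤ ∑' j, a j := fun k => ha.le_tsum k fun j _ => ha0 j
  refine Summable.of_nonneg_of_le (fun k => ?_) (fun k => ?_) (hlog.mul_left (1 + ∑' j, a j))
  · exact mul_nonneg (by linarith [ha0 k]) (Real.log_nonneg (by linarith [ha0 k]))
  · exact mul_le_mul_of_nonneg_right (by linarith [hbd k])
      (Real.log_nonneg (by linarith [ha0 k]))

end RenormEntropy

theorem mainTheorem3 {H : Type*} [NormedAddCommGroup H] [InnerProductSpace ℂ H]
    [CompleteSpace H] [TopologicalSpace.SeparableSpace H]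
    (Q₁ Q₂ : H →L[ℂ] H) (hQ₁ : RenormEntropy.IsState Q₁) (hQ₂ : RenormEntropy.IsState Q₂)
    (hmaj : RenormEntropy.MMajorizedBy
      (RenormEntropy.entropyOpPlus Q₁) (RenormEntropy.entropyOpPlus Q₂)) :
    -- the infinite products that define the entropies converge, to nonzero limits
    (∀ Q ∈ ({Q₁, Q₂} : Set (H →L[ℂ] H)),
      Summable fun k => (1 + RenormEntropy.eigenvalueSeq Q k) *
        Real.log (1 + RenormEntropy.eigenvalueSeq Q k)) ∧
    RenormEntropy.FENplus Q₁ ≤ RenormEntropy.FENplus Q₂ ∧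
    RenormEntropy.FENminus Q₁ ≥ RenormEntropy.FENminus Q₂ ∧
    (RenormEntropy.FENplus Q₁ = RenormEntropy.FENplus Q₂ ↔
      RenormEntropy.eigenvalueSeq Q₁ = RenormEntropy.eigenvalueSeq Q₂) ∧
    (RenormEntropy.FENminus Q₁ = RenormEntropy.FENminus Q₂ ↔
      RenormEntropy.eigenvalueSeq Q₁ = RenormEntropy.eigenvalueSeq Q₂) := by
  obtain ⟨hanti₁, hnn₁, hsum₁, hgram₁⟩ := hQ₁.exists_eigenvalueSeq
  obtain ⟨-, hnn₂, hsum₂, hgram₂⟩ := hQ₂.exists_eigenvalueSeq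
  have hs₁ := RenormEntropy.summable_one_add_mul_log hnn₁ hsum₁.summable
  have hs₂ := RenormEntropy.summable_one_add_mul_log hnn₂ hsum₂.summable
  have hpos₁ : ∀ k, 0 < 1 + RenormEntropy.eigenvalueSeq Q₁ k := fun k => by linarith [hnn₁ k]
  have hpos₂ : ∀ k, 0 < 1 + RenormEntropy.eigenvalueSeq Q₂ k := fun k => by linarith [hnn₂ k]
  have hle : ∀ n, ∑ k ∈ Finset.range n, (1 + RenormEntropy.eigenvalueSeq Q₁ k) *
        Real.log (1 + RenormEntropy.eigenvalueSeq Q₁ k) ≤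
      ∑ k ∈ Finset.range n, (1 + RenormEntropy.eigenvalueSeq Q₂ k) *
        Real.log (1 + RenormEntropy.eigenvalueSeq Q₂ k) := by
    intro n
    have h := hmaj n
    rw [hgram₁, hgram₂] at h
    have h' := Real.log_le_log
      (Finset.prod_pos fun k _ => Real.rpow_pos_of_pos (hpos₁ k) _) h
    rw [Real.log_prod fun k _ => (Real.rpow_pos_of_pos (hpos₁ k) _).ne',
      Real.log_prod fun k _ => (Real.rpow_pos_of_pos (hpos₂ k) _).ne'] at h'
    simpa only [Real.log_rpow (hpos₁ _), Real.log_rpow (hpos₂ _)] using h'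
  have hF₁ := RenormEntropy.FENplus_eq_tsum hnn₁ hs₁
  have hF₂ := RenormEntropy.FENplus_eq_tsum hnn₂ hs₂
  have hFle : RenormEntropy.FENplus Q₁ ≤ RenormEntropy.FENplus Q₂ := by
    rw [hF₁, hF₂]
    exact le_of_tendsto_of_tendsto' hs₁.hasSum.tendsto_sum_nat hs₂.hasSum.tendsto_sum_nat hle
  have hiff : RenormEntropy.FENplus Q₁ = RenormEntropy.FENplus Q₂ ↔
      RenormEntropy.eigenvalueSeq Q₁ = RenormEntropy.eigenvalueSeq Q₂ := by
    refine ⟨fun h => ?_, fun h => by rw [RenormEntropy.FENplus, RenormEntropy.FENplus, h]⟩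
    refine RenormEntropy.eq_of_partial_sums_le_of_tsum_eq hanti₁ hnn₁ hnn₂ hsum₁ hsum₂ hs₁.hasSum
      ?_ hle
    rw [← hF₁, h, hF₂]
    exact hs₂.hasSum
  have hm₁ := RenormEntropy.FENminus_eq_neg_FENplus hnn₁ hs₁
  have hm₂ := RenormEntropy.FENminus_eq_neg_FENplus hnn₂ hs₂
  refine ⟨?_, hFle, ?_, hiff, ?_⟩
  · rintro Q (rfl | rfl)
    exacts [hs₁, hs₂]
  · rw [hm₁, hm₂]
    exact neg_le_neg hFle
  · rw [hm₁, hm₂, neg_inj, hiff]
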